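/- \textbf{Setting.} There are $K\ge 1$ slices with unknown loads $\boldsymbol\mu=(\mu_1,\dots,\mu_K)$. Measuring slice $k$ in a time slot gives a sample with mean $\mu_k$ from a fixed one-parameter exponential family on $\mathbb R$ (laws proportional to $e^{\theta x}\rho(dx)$ with $\theta$ in an open interval $\Theta$ on which $\int e^{\theta x}\rho(dx)<\infty$, where $\rho$ is not carried by a single point; e.g. Bernoulli with means in $(0,1)$ or Poisson with means in $(0,\infty)$), all measurements being independent. All loads, and the threshold $\gamma$, range over the set of means of the family. Let $d(a,b)$ be the Kullback--Leibler divergence between the members with means $a$ and $b$, and $d_B(a,b)$ the one between the Bernoulli distributions with means $a$ and $b$. Slice $k$ is \emph{available} if $\mu_k<\gamma$. Let $\mu_\star=\min_k\mu_k$. The set $\mathcal C(\boldsymbol\mu)\subseteq\{0,1,\dots,K\}$ of correct answers ($0$ means rejection) is $\{0\}$ if $\mu_\star\ge\gamma$; if $\mu_\star<\gamma$ it is, according to the criterion, the set of all available slices (any available slice), the set of available slices of largest load (packing slice), or the set of slices of smallest load (least loaded slice). An \emph{algorithm} consists of a sampling strategy (the slice probed in slot $t$ is a measurable function of the first $t-1$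 observations), a stopping time $\tau$ of the filtration of the observations, and an $\mathcal F_\tau$-measurable decision $\hat k\in\{0,1,\dots,K\}$. It is \emph{$\delta$-PC} for a criterion if $\mathbb P_{\boldsymbol\mu}[\tau<\infty]=1$ and $\mathbb P_{\boldsymbol\mu}[\hat k\notin\mathcal C(\boldsymbol\mu)]\le\delta$ for every identifiable $\boldsymbol\mu$. Identifiable means: $\mu_\star\ne\gamma$ for any available slice; $\mu_\star\ne\gamma$ and the least loaded slice is unique in case $\mu_\star<\gamma$, for least loaded slice; $\mu_k\ne\gamma$ for all $k$ and the most loaded available slice is unique in case $\mu_\star<\gamma$, for packing slice. (An algorithm for which this holds for a larger set of $\boldsymbol\mu$ is a fortiori $\delta$-PC.) \textbf{Proposition.} Consider any of the three criteria, and let $\boldsymbol\mu$ satisfy $\mu_\star\neq\gamma$ and $\mathcal C(\boldsymbol\mu)=\{0\}$ (no slice is available). Put $T_0(\boldsymbol\mu)=\sum_{k=1}^K d(\mu_k,\gamma)^{-1}$. (i) For every $\delta\in(0,1/2]$, every $\delta$-PC algorithm satisfies $$\mathbb E_{\boldsymbol\mu}[\tau]\ \ge\ T_0(\boldsymbol\mu)\,d_B(\delta,1-\delta).$$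 (ii) Over the simplex $\Lambda=\{\boldsymbol w\in[0,1]^K:\sum_k w_k=1\}$, the function $$\boldsymbol w\mapsto\max_{a\in\mathcal C(\boldsymbol\mu)}\ \inf_{\boldsymbol\lambda:\,a\notin\mathcal C(\boldsymbol\lambda)}\ \sum_{k=1}^K w_k\,d(\mu_k,\lambda_k)$$ has maximum $T_0(\boldsymbol\mu)^{-1}$, and its unique maximizer (the optimal proportions of measurements) is $$w^\star_k=\frac{d(\mu_k,\gamma)^{-1}}{T_0(\boldsymbol\mu)},\qquad k=1,\dots,K.$$ -/

import Mathlib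

open MeasureTheory ProbabilityTheory Set
open scoped ENNReal

noncomputable section

namespace AdmissionControl

/-! ### One-parameter exponential families, parametrized by their means -/

/-- A one-parameter natural exponential family on `ℝ`: the laws proportional to
`exp (θ x) base(dx)`, where the natural parameter `θ` ranges over an open interval `natParams`
(for instance Bernoulli, Poisson, Gaussian with fixed variance).
The base measure is not carried by a single point. -/
structure ExpFamily where
  base : Measure ℝ
  natParams : Set ℝ
  isOpen_natParams : IsOpen natParams
  ordConnected_natParams : natParams.OrdConnected
  integrable_exp : ∀ θ ∈ natParams, Integrable (fun x : ℝ => Real.exp (θ * x)) base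
  nondegenerate : ∀ c : ℝ, base {c}ᶜ ≠ 0

namespace ExpFamily

/-- The set of means of the members of the family. -/
def means (E : ExpFamily) : Set ℝ :=
  {m | ∃ θ ∈ E.natParams, ∫ x, x ∂(E.base.tilted (fun x => θ * x)) = m}

/-- The natural parameter of the member with mean `m` (it is unique). -/
def natParam (E : ExpFamily) (m : E.means) : ℝ := m.2.choose

/-- The member of the family with mean `m`. -/
def law (E : ExpFamily) (m : E.means) : Measure ℝ :=
  E.base.tilted (fun x => E.natParam m * x)

instance (E : ExpFamily) (m : E.means) : IsProbabilityMeasure (E.law m) := by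
  have : NeZero E.base := ⟨fun h => E.nondegenerate 0 (by simp [h])⟩
  exact isProbabilityMeasure_tilted (E.integrable_exp _ m.2.choose_spec.1)

/-- `d(a, b)`: the Kullback-Leibler divergence between the members with means `a` and `b`. -/
def d (E : ExpFamily) (a b : E.means) : ℝ≥0∞ := InformationTheory.klDiv (E.law a) (E.law b)

end ExpFamily

/-- `d_B(a, b)`: the Kullback-Leibler divergence between the Bernoulli distributions
with means `a` and `b`. -/
def dB (a b : unitInterval) : ℝ≥0∞ :=
  InformationTheory.klDiv (bernoulliMeasure (1 : ℝ) 0 a) (bernoulliMeasure (1 : ℝ) 0 b)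

/-! ### Admission criteria and correct answers -/

/-- The three admission criteria. -/
inductive Criterion where
  | anyAvailable
  | packing
  | leastLoaded

/-- `μ_⋆`: the smallest load. -/
def minLoad {K : ℕ} [NeZero K] {α : Type*} [LinearOrder α] (μ : Fin K → α) : α :=
  Finset.univ.inf' Finset.univ_nonempty μ

/-- The correct answers for the loads `μ` and the threshold `γ`. The answer `0` is to reject the
flow, the answer `k.succ` is to select slice `k`. When several slices tie for the most loaded
available slice, or for the least loaded slice, all of them are listed. -/
def correctAnswers {K : ℕ} [NeZero K] {α : Type*} [LinearOrder α]
    (c : Criterion) (γ : α) (μ : Fin K → α) : Set (Fin (K + 1)) :=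
  if minLoad μ < γ then
    match c with
    | .anyAvailable => Fin.succ '' {k | μ k < γ}
    | .packing => Fin.succ '' {k | μ k < γ ∧ ∀ j, μ j < γ → μ j ≤ μ k}
    | .leastLoaded => Fin.succ '' {k | μ k = minLoad μ}
  else {0}

/-- The instances on which correctness is demanded: the pathological loads, at which a correct
answer cannot be identified even with infinitely many measurements, are left out. -/
def Identifiable {K : ℕ} [NeZero K] {α : Type*} [LinearOrder α]
    (c : Criterion) (γ : α) (μ : Fin K → α) : Prop :=
  match c with
  | .anyAvailable => minLoad μ ≠ γ
  | .packing => (∀ k, μ k ≠ γ) ∧ (correctAnswers .packing γ μ).Subsingleton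
  | .leastLoaded => minLoad μ ≠ γ ∧ (correctAnswers .leastLoaded γ μ).Subsingleton

/-! ### Measurements and algorithms -/

/-- Sample space of the measurements: `ω t k` is the number of packets handled by slice `k`
in slot `t + 1`. -/
abbrev Table (K : ℕ) : Type := ℕ → Fin K → ℝ

/-- `P_μ`: all the measurements are independent, those of slice `k` follow the member of the
family with mean `μ k`. -/
def tableLaw (E : ExpFamily) {K : ℕ} (μ : Fin K → E.means) : Measure (Table K) :=
  Measure.infinitePi (fun _ : ℕ => Measure.pi (fun k => E.law (μ k)))

/-- The `σ`-algebra generated by the first `n` pairs (slice probed, measurement observed), when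
slice `arm t ω` is probed in slot `t + 1`. -/
@[reducible] def obsSigma {K : ℕ} (arm : ℕ → Table K → Fin K) (n : ℕ) : MeasurableSpace (Table K) :=
  ⨆ (s : ℕ) (_ : s < n),
    MeasurableSpace.comap (fun ω : Table K => (arm s ω, ω s (arm s ω))) inferInstance

/-- A sampling strategy: the slice `arm t` probed in slot `t + 1` is a function of the first `t`
observations. -/
structure SamplingStrategy (K : ℕ) where
  arm : ℕ → Table K → Fin K
  measurable_arm : ∀ t, Measurable[obsSigma arm t] (arm t)

namespace SamplingStrategy

theorem obsSigma_le {K : ℕ} (S : SamplingStrategy K) (n : ℕ) :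
    obsSigma S.arm n ≤ (inferInstance : MeasurableSpace (Table K)) := by
  induction n using Nat.strong_induction_on with
  | _ n ih =>
    refine iSup₂_le fun s hs => ?_
    have harm : Measurable (S.arm s) := (S.measurable_arm s).mono (ih s hs) le_rfl
    have hval : Measurable (fun ω : Table K => ω s (S.arm s ω)) := by
      have h : Measurable (fun p : Fin K × (Fin K → ℝ) => p.2 p.1) :=
        measurable_from_prod_countable_right fun k => measurable_pi_apply k
      exact h.comp (harm.prodMk (measurable_pi_apply s))
    exact (harm.prodMk hval).comap_le

/-- The filtration of the observations. -/
def filtration {K : ℕ} (S : SamplingStrategy K) :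
    Filtration ℕ (inferInstance : MeasurableSpace (Table K)) where
  seq := obsSigma S.arm
  mono' := fun _ _ hmn =>
    iSup₂_le fun s hs => le_iSup₂_of_le s (lt_of_lt_of_le hs hmn) le_rfl
  le' := S.obsSigma_le

end SamplingStrategy

/-- A joint measurement and decision algorithm: a sampling strategy, a stopping time `τ` of the
filtration of the observations (possibly infinite), and an `F_τ`-measurable decision. -/
structure Algorithm (K : ℕ) extends SamplingStrategy K where
  τ : Table K → WithTop ℕ
  isStoppingTime : IsStoppingTime toSamplingStrategy.filtration τ
  decision : Table K → Fin (K + 1)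
  measurable_decision : Measurable[isStoppingTime.measurableSpace] decision

namespace Algorithm

/-- `E_μ[τ]`: the expected number of measurements. -/
def expectedCost {K : ℕ} (A : Algorithm K) (E : ExpFamily) (μ : Fin K → E.means) : ℝ≥0∞ :=
  ∫⁻ ω, ENat.toENNReal (A.τ ω) ∂(tableLaw E μ)

/-- `δ`-probably correct algorithms. -/
def IsPC {K : ℕ} [NeZero K] (A : Algorithm K) (E : ExpFamily) (γ : E.means) (c : Criterion)
    (δ : ℝ) : Prop :=
  ∀ μ : Fin K → E.means, Identifiable c γ μ →
    tableLaw E μ {ω | A.τ ω < ⊤} = 1 ∧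
    tableLaw E μ {ω | A.decision ω ∉ correctAnswers c γ μ} ≤ ENNReal.ofReal δ

end Algorithm

/-! ### The lower-bound optimization problem -/

/-- The loads under which `a` is not a correct answer. -/
def alt (E : ExpFamily) {K : ℕ} [NeZero K] (γ : E.means) (c : Criterion) (a : Fin (K + 1)) :
    Set (Fin K → E.means) :=
  {ν | a ∉ correctAnswers c γ ν}

/-- The objective
`w ↦ max_{a correct for μ} inf_{ν ∈ Alt(a)} ∑ k, w k * d(μ k, ν k)`. -/
def objective (E : ExpFamily) {K : ℕ} [NeZero K] (γ : E.means) (c : Criterion)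
    (μ : Fin K → E.means) (w : Fin K → ℝ) : ℝ≥0∞ :=
  ⨆ a ∈ correctAnswers c γ μ, ⨅ ν ∈ alt E γ c a, ∑ k, ENNReal.ofReal (w k) * E.d (μ k) (ν k)

/-- The optimal proportions of measurements: the maximizers of the objective over the simplex. -/
def optimalProportions (E : ExpFamily) {K : ℕ} [NeZero K] (γ : E.means) (c : Criterion)
    (μ : Fin K → E.means) : Set (Fin K → ℝ) :=
  {w | w ∈ stdSimplex ℝ (Fin K) ∧
    ∀ v ∈ stdSimplex ℝ (Fin K), objective E γ c μ v ≤ objective E γ c μ w}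

/-- `T₀(μ) = ∑ k, d(μ k, γ)⁻¹`. -/
def T₀ (E : ExpFamily) {K : ℕ} (γ : E.means) (μ : Fin K → E.means) : ℝ≥0∞ :=
  ∑ k, (E.d (μ k) γ)⁻¹

end AdmissionControl

end

/-! When no slice is available and `μ_⋆ ≠ γ`, every load lies strictly above `γ`, and rejection
stops being correct exactly when some load drops strictly below `γ`. The cheapest way to achieve
this is to move a single load `μ k` to a value `b < γ` and to let `b` tend to `γ`. Such a one-slice
change leaves one available slice, hence is identifiable under every criterion, which is why one
argument serves all three.

Lower bound: write `ν` for `μ` with `μ k` replaced by `b`. The event "reject" has probability at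
least `1 - δ` under `μ` and at most `δ` under `ν`. Change of measure up to the stopping time
(`setLIntegral_stoppedRatio`), Wald's identity (`integral_stoppedLlr`) and `x + 1 ≤ exp x`, applied
to a two-valued test function minus the log-likelihood ratio (`mul_log_le_sum_probed`), show that
the expected number of probes of slice `k` times `d(μ k, b)` is at least `d_B(δ, 1 - δ)`. Since `d(μ
k, ·)` is approached at `γ` from below (`exists_seq_lt_tendsto_d`), `b` may be replaced by `γ`;
dividing by `d(μ k, γ)` and summing over the slices bounds the cost.

Optimization: by the same one-slice changes and the monotonicity of `d` (`d_le_d`), the objective is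
`min_k w k * d(μ k, γ)` (`objective_eq_iInf`). A weight vector with value at least `1 / T₀`
dominates the balanced one in every coordinate; as both have sum `1`, they coincide. -/

noncomputable section

namespace AdmissionControl

/-! ### Divergence, means and natural parameters of the exponential family -/

namespace ExpFamily

open Filter Topology InformationTheory

/-- The member of the family with natural parameter `θ`. -/
def member (E : ExpFamily) (θ : ℝ) : Measure ℝ := E.base.tilted (fun x => θ * x)

/-- The mean of the member with natural parameter `θ`. -/
def mean (E : ExpFamily) (θ : ℝ) : ℝ := ∫ x, x ∂(E.member θ)

/-- The log-partition function. -/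
def logPartition (E : ExpFamily) (θ : ℝ) : ℝ := Real.log (∫ x, Real.exp (θ * x) ∂E.base)

variable (E : ExpFamily) {θ θ' : ℝ}

instance : NeZero E.base := ⟨fun h => E.nondegenerate 0 (by simp [h])⟩

theorem isProbabilityMeasure_member (hθ : θ ∈ E.natParams) : IsProbabilityMeasure (E.member θ) :=
  isProbabilityMeasure_tilted (E.integrable_exp θ hθ)

theorem mem_interior (hθ : θ ∈ E.natParams) : θ ∈ interior (integrableExpSet id E.base) :=
  _root_.mem_interior.2 ⟨E.natParams, fun t ht => E.integrable_exp t ht, E.isOpen_natParams, hθ⟩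

theorem integrable_id_member (hθ : θ ∈ E.natParams) :
    Integrable (fun x : ℝ => x) (E.member θ) := by
  have h := memLp_tilted_mul (E.mem_interior hθ) 1
  exact memLp_one_iff_integrable.1 h

theorem member_eq_tilted (hθ' : θ' ∈ E.natParams) :
    E.member θ = (E.member θ').tilted (fun x => (θ - θ') * x) := by
  rw [member, member, tilted_tilted (E.integrable_exp θ' hθ')]
  congr 1
  ext x
  simp only [Pi.add_apply]
  ring

theorem integrable_exp_sub (hθ : θ ∈ E.natParams) (hθ' : θ' ∈ E.natParams) :
    Integrable (fun x => Real.exp ((θ - θ') * x)) (E.member θ') := by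
  rw [member, integrable_tilted_iff (E.integrable_exp θ' hθ')]
  refine (E.integrable_exp θ hθ).congr (ae_of_all _ fun x => ?_)
  simp only [smul_eq_mul, ← Real.exp_add]
  ring_nf

theorem partition_pos (hθ : θ ∈ E.natParams) : 0 < ∫ x, Real.exp (θ * x) ∂E.base :=
  integral_exp_pos (E.integrable_exp θ hθ)

theorem log_integral_exp_sub (hθ : θ ∈ E.natParams) (hθ' : θ' ∈ E.natParams) :
    Real.log (∫ x, Real.exp ((θ - θ') * x) ∂(E.member θ')) =
      E.logPartition θ - E.logPartition θ' := by
  rw [member, integral_exp_tilted, logPartition, logPartition,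
    ← Real.log_div (E.partition_pos hθ).ne' (E.partition_pos hθ').ne']
  congr 4 with x
  simp only [Pi.add_apply]
  ring_nf

theorem absolutelyContinuous_member (hθ' : θ' ∈ E.natParams) :
    E.member θ ≪ E.member θ' := by
  rw [E.member_eq_tilted hθ']
  exact tilted_absolutelyContinuous _ _

theorem llr_member (hθ : θ ∈ E.natParams) (hθ' : θ' ∈ E.natParams) :
    llr (E.member θ) (E.member θ') =ᵐ[E.member θ']
      fun x => (θ - θ') * x - (E.logPartition θ - E.logPartition θ') := by
  have := E.isProbabilityMeasure_member hθ'
  have h := log_rnDeriv_tilted_left_self (E.integrable_exp_sub hθ hθ')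
  rw [E.log_integral_exp_sub hθ hθ', ← E.member_eq_tilted hθ'] at h
  exact h

theorem integrable_llr_member (hθ : θ ∈ E.natParams) (hθ' : θ' ∈ E.natParams) :
    Integrable (llr (E.member θ) (E.member θ')) (E.member θ) := by
  have := E.isProbabilityMeasure_member hθ
  have h := (E.absolutelyContinuous_member (θ := θ) hθ').ae_le (E.llr_member hθ hθ')
  refine Integrable.congr ?_ (EventuallyEq.symm h)
  exact ((E.integrable_id_member hθ).const_mul _).sub (integrable_const _)

theorem toReal_klDiv_member (hθ : θ ∈ E.natParams) (hθ' : θ' ∈ E.natParams) :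
    (klDiv (E.member θ) (E.member θ')).toReal =
      (θ - θ') * E.mean θ - (E.logPartition θ - E.logPartition θ') := by
  have := E.isProbabilityMeasure_member hθ
  have := E.isProbabilityMeasure_member hθ'
  rw [toReal_klDiv_of_measure_eq (E.absolutelyContinuous_member hθ') (by simp),
    integral_congr_ae ((E.absolutelyContinuous_member hθ').ae_le (E.llr_member hθ hθ')),
    integral_sub ((E.integrable_id_member hθ).const_mul _) (integrable_const _),
    integral_const_mul]
  simp [mean]

theorem klDiv_member_ne_top (hθ : θ ∈ E.natParams) (hθ' : θ' ∈ E.natParams) :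
    klDiv (E.member θ) (E.member θ') ≠ ⊤ :=
  klDiv_ne_top (E.absolutelyContinuous_member hθ') (E.integrable_llr_member hθ hθ')

/-- If two parameters gave the same law, the log-likelihood ratio, affine in `x` with nonzero slope,
would vanish almost everywhere, and the base measure would be carried by one point. -/
theorem member_injOn : InjOn E.member E.natParams := by
  intro θ hθ θ' hθ' h
  by_contra hne
  have := E.isProbabilityMeasure_member hθ'
  have h1 := E.llr_member hθ hθ'
  rw [h] at h1
  have h2 : ∀ᵐ x ∂E.base, x = (E.logPartition θ - E.logPartition θ') / (θ - θ') := by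
    refine (absolutelyContinuous_tilted (E.integrable_exp θ' hθ')).ae_le ?_
    filter_upwards [h1, llr_self (E.member θ')] with x hx hx'
    rw [hx'] at hx
    rw [eq_div_iff (sub_ne_zero.2 hne)]
    simp only [Pi.zero_apply] at hx
    linarith
  exact E.nondegenerate _ h2

/-- The sum of the divergences in both directions is `(θ' - θ) * (mean θ' - mean θ)`: the
log-partition terms cancel. It is positive because the two members differ. -/
theorem strictMonoOn_mean : StrictMonoOn E.mean E.natParams := by
  intro θ hθ θ' hθ' hlt
  have := E.isProbabilityMeasure_member hθ
  have := E.isProbabilityMeasure_member hθ'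
  have h1 := E.toReal_klDiv_member hθ hθ'
  have h2 := E.toReal_klDiv_member hθ' hθ
  have h3 : 0 < (klDiv (E.member θ) (E.member θ')).toReal := by
    refine ENNReal.toReal_pos (fun h0 => ?_) (E.klDiv_member_ne_top hθ hθ')
    exact hlt.ne (E.member_injOn hθ hθ' (klDiv_eq_zero_iff.1 h0))
  have h4 : 0 ≤ (klDiv (E.member θ') (E.member θ)).toReal := ENNReal.toReal_nonneg
  have h5 : 0 < (θ' - θ) * (E.mean θ' - E.mean θ) := by nlinarith
  have := pos_of_mul_pos_right h5 (sub_pos.2 hlt).le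
  linarith

theorem continuousAt_logPartition (hθ : θ ∈ E.natParams) : ContinuousAt E.logPartition θ := by
  have h : ContinuousAt (mgf id E.base) θ := (differentiableAt_mgf (E.mem_interior hθ)).continuousAt
  exact h.log (E.partition_pos hθ).ne'

theorem natParam_mem (m : E.means) : E.natParam m ∈ E.natParams := m.2.choose_spec.1

theorem mean_natParam (m : E.means) : E.mean (E.natParam m) = m := m.2.choose_spec.2

theorem law_eq_member (m : E.means) : E.law m = E.member (E.natParam m) := rfl

theorem natParam_mk (hθ : θ ∈ E.natParams) : E.natParam ⟨E.mean θ, θ, hθ, rfl⟩ = θ :=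
  E.strictMonoOn_mean.injOn (E.natParam_mem _) hθ (E.mean_natParam _)

theorem natParam_le_natParam {a b : E.means} (h : a ≤ b) : E.natParam a ≤ E.natParam b := by
  rw [← E.strictMonoOn_mean.le_iff_le (E.natParam_mem a) (E.natParam_mem b), mean_natParam,
    mean_natParam]
  exact h

theorem law_absolutelyContinuous (a b : E.means) : E.law a ≪ E.law b :=
  E.absolutelyContinuous_member (E.natParam_mem b)

theorem integrable_llr_law (a b : E.means) : Integrable (llr (E.law a) (E.law b)) (E.law a) :=
  E.integrable_llr_member (E.natParam_mem a) (E.natParam_mem b)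

theorem d_ne_top (a b : E.means) : E.d a b ≠ ⊤ :=
  E.klDiv_member_ne_top (E.natParam_mem a) (E.natParam_mem b)

theorem toReal_d (a b : E.means) :
    (E.d a b).toReal = (E.natParam a - E.natParam b) * a -
      (E.logPartition (E.natParam a) - E.logPartition (E.natParam b)) := by
  rw [d, law_eq_member, law_eq_member, E.toReal_klDiv_member (E.natParam_mem a) (E.natParam_mem b),
    mean_natParam]

theorem toReal_d_eq_integral_llr (a b : E.means) :
    (E.d a b).toReal = ∫ x, llr (E.law a) (E.law b) x ∂(E.law a) :=
  toReal_klDiv_of_measure_eq (E.law_absolutelyContinuous a b) (by simp)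

theorem d_self (a : E.means) : E.d a a = 0 := klDiv_self _

theorem d_ne_zero {a b : E.means} (h : a ≠ b) : E.d a b ≠ 0 := by
  intro h0
  have h1 : E.law a = E.law b := klDiv_eq_zero_iff.1 h0
  have h2 := E.member_injOn (E.natParam_mem a) (E.natParam_mem b) h1
  apply h
  ext
  rw [← E.mean_natParam a, h2, E.mean_natParam]

/-- The three-point identity `d(a, b) = d(a, c) + d(c, b) + (θ_c - θ_b) * (a - c)`, whose last two
terms are nonnegative here. -/
theorem d_le_d {a b c : E.means} (hbc : b ≤ c) (hca : c ≤ a) : E.d a c ≤ E.d a b := by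
  rw [← ENNReal.toReal_le_toReal (E.d_ne_top _ _) (E.d_ne_top _ _), toReal_d, toReal_d]
  have h1 : 0 ≤ (E.d c b).toReal := ENNReal.toReal_nonneg
  rw [toReal_d] at h1
  have h2 : (0 : ℝ) ≤ (E.natParam c - E.natParam b) * ((a : ℝ) - c) :=
    mul_nonneg (sub_nonneg.2 (E.natParam_le_natParam hbc)) (sub_nonneg.2 hca)
  nlinarith

/-- Availability is a strict inequality, so `c` itself must be approached by means below it. These
exist because the parameter set is open, and the divergences converge because the log-partition
function is continuous. -/
theorem exists_seq_lt_tendsto_d (a c : E.means) :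
    ∃ u : ℕ → E.means, (∀ n, u n < c) ∧ Tendsto (fun n => E.d a (u n)) atTop (𝓝 (E.d a c)) := by
  obtain ⟨ε, hε, hsub⟩ := Metric.isOpen_iff.1 E.isOpen_natParams _ (E.natParam_mem c)
  set θ := E.natParam c with hθ
  -- Half the radius keeps every shifted parameter inside the open ball contained in `natParams`.
  have hstep : ∀ n : ℕ, 0 < ε / 2 / ((n : ℝ) + 1) := fun n => by positivity
  have hmem : ∀ n : ℕ, θ - ε / 2 / ((n : ℝ) + 1) ∈ E.natParams := by
    intro n
    apply hsub
    have h1 : ε / 2 / ((n : ℝ) + 1) ≤ ε / 2 :=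
      div_le_self (by positivity) (by linarith [n.cast_nonneg (α := ℝ)])
    have h2 := hstep n
    rw [Metric.mem_ball, Real.dist_eq, abs_lt]
    constructor <;> linarith
  have hlim : Tendsto (fun n : ℕ => θ - ε / 2 / ((n : ℝ) + 1)) atTop (𝓝 θ) := by
    have h1 : Tendsto (fun n : ℕ => ε / 2 / ((n : ℝ) + 1)) atTop (𝓝 0) :=
      tendsto_const_nhds.div_atTop
        (tendsto_atTop_add_const_right _ _ tendsto_natCast_atTop_atTop)
    simpa using h1.const_sub θ
  refine ⟨fun n => ⟨E.mean (θ - ε / 2 / ((n : ℝ) + 1)), _, hmem n, rfl⟩, fun n => ?_, ?_⟩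
  · rw [← Subtype.coe_lt_coe, ← E.mean_natParam c]
    exact E.strictMonoOn_mean (hmem n) (E.natParam_mem c) (by have := hstep n; linarith)
  · rw [← ENNReal.tendsto_toReal_iff (fun n => E.d_ne_top _ _) (E.d_ne_top _ _)]
    simp only [toReal_d, E.natParam_mk (hmem _), ← hθ]
    exact ((tendsto_const_nhds.sub hlim).mul_const _).sub
      (tendsto_const_nhds.sub ((E.continuousAt_logPartition (E.natParam_mem c)).tendsto.comp hlim))

end ExpFamily

end AdmissionControl

/-! ### Independence of successive slots and change of measure at a fixed time -/

namespace AdmissionControl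

open Filter Topology

variable {K : ℕ} (E : ExpFamily)

instance (μ : Fin K → E.means) : IsProbabilityMeasure (tableLaw E μ) := by
  unfold tableLaw; infer_instance

theorem measurePreserving_entry (μ : Fin K → E.means) (n : ℕ) (j : Fin K) :
    MeasurePreserving (fun ω : Table K => ω n j) (tableLaw E μ) (E.law (μ j)) :=
  (measurePreserving_eval (fun k => E.law (μ k)) j).comp
    (measurePreserving_eval_infinitePi (fun _ : ℕ => Measure.pi (fun k => E.law (μ k))) n)

namespace SamplingStrategy

variable (S : SamplingStrategy K)

theorem obsSigma_mono {m n : ℕ} (h : m ≤ n) : obsSigma S.arm m ≤ obsSigma S.arm n :=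
  S.filtration.mono h

theorem obsSigma_succ (n : ℕ) :
    obsSigma S.arm (n + 1) = obsSigma S.arm n ⊔
      MeasurableSpace.comap (fun ω : Table K => (S.arm n ω, ω n (S.arm n ω))) inferInstance := by
  apply le_antisymm
  · refine iSup₂_le fun s hs => ?_
    rcases Nat.lt_succ_iff_lt_or_eq.1 hs with h | rfl
    · exact le_sup_of_le_left (le_iSup₂_of_le s h le_rfl)
    · exact le_sup_right
  · exact sup_le (S.obsSigma_mono n.le_succ) (le_iSup₂_of_le n n.lt_succ_self le_rfl)

theorem measurable_observation (n : ℕ) :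
    Measurable[obsSigma S.arm (n + 1)] (fun ω : Table K => (S.arm n ω, ω n (S.arm n ω))) := by
  rw [S.obsSigma_succ]
  exact (comap_measurable _).mono le_sup_right le_rfl

theorem obsSigma_le_iSup_comap (n : ℕ) :
    obsSigma S.arm n ≤
      ⨆ s ∈ Iio n, MeasurableSpace.comap (fun ω : Table K => ω s) inferInstance := by
  induction n with
  | zero => exact iSup₂_le fun s hs => absurd hs (Nat.not_lt_zero s)
  | succ n ih =>
    have h1 : obsSigma S.arm n ≤ ⨆ s ∈ Iio (n + 1),
        MeasurableSpace.comap (fun ω : Table K => ω s) inferInstance :=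
      ih.trans (iSup₂_le fun s hs => le_iSup₂_of_le s (Nat.lt_succ_of_lt hs) le_rfl)
    rw [S.obsSigma_succ]
    refine sup_le h1 ?_
    set m : MeasurableSpace (Table K) := ⨆ s ∈ Iio (n + 1),
        MeasurableSpace.comap (fun ω : Table K => ω s) inferInstance with hm
    have harm : Measurable[m] (S.arm n) := (S.measurable_arm n).mono h1 le_rfl
    have hrow : Measurable[m] (fun ω : Table K => ω n) :=
      (comap_measurable _).mono (le_iSup₂_of_le n n.lt_succ_self le_rfl) le_rfl
    have h : Measurable (fun p : Fin K × (Fin K → ℝ) => p.2 p.1) :=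
      measurable_from_prod_countable_right fun k => measurable_pi_apply k
    have hval : Measurable[m] (fun ω : Table K => ω n (S.arm n ω)) := h.comp (harm.prodMk hrow)
    exact (harm.prodMk hval).comap_le

/-- The first `n` observations are functions of the rows before row `n`, and the rows are
independent. Row `n` is therefore fresh, even though the entry read from it is chosen from the past.
-/
theorem indep_obsSigma (μ : Fin K → E.means) (n : ℕ) :
    Indep (obsSigma S.arm n) (MeasurableSpace.comap (fun ω : Table K => ω n) inferInstance)
      (tableLaw E μ) := by
  have hind : iIndep
      (fun s : ℕ => MeasurableSpace.comap (fun ω : Table K => ω s) inferInstance)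
      (tableLaw E μ) :=
    iIndepFun_infinitePi (P := fun _ : ℕ => Measure.pi (fun k => E.law (μ k)))
      (X := fun _ ω => ω) (fun _ => measurable_id)
  have h := indep_iSup_of_disjoint (S := Iio n) (T := {n})
    (fun s => (measurable_pi_apply s).comap_le) hind (by simp)
  exact indep_of_indep_of_le_right (indep_of_indep_of_le_left h (S.obsSigma_le_iSup_comap n))
    (le_iSup₂_of_le n rfl le_rfl)

theorem lintegral_mul_entry (μ : Fin K → E.means) (n : ℕ) (j : Fin K) {f : Table K → ℝ≥0∞}
    (hf : Measurable[obsSigma S.arm n] f) {g : ℝ → ℝ≥0∞} (hg : Measurable g) :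
    ∫⁻ ω, f ω * g (ω n j) ∂(tableLaw E μ) =
      (∫⁻ ω, f ω ∂(tableLaw E μ)) * ∫⁻ x, g x ∂(E.law (μ j)) := by
  have hgn : Measurable[MeasurableSpace.comap (fun ω : Table K => ω n) inferInstance]
      (fun ω : Table K => g (ω n j)) :=
    Measurable.comp (g := fun r : Fin K → ℝ => g (r j))
      (hg.comp (measurable_pi_apply j)) (comap_measurable (fun ω : Table K => ω n))
  rw [lintegral_mul_eq_lintegral_mul_lintegral_of_independent_measurableSpace
    (S.obsSigma_le n) (measurable_pi_apply n).comap_le (S.indep_obsSigma E μ n) hf hgn,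
    (measurePreserving_entry E μ n j).lintegral_comp hg]

theorem integral_indicator_entry (μ : Fin K → E.means) (n : ℕ) (j : Fin K) {A : Set (Table K)}
    (hA : MeasurableSet[obsSigma S.arm n] A) {g : ℝ → ℝ} (hg : Measurable g) :
    ∫ ω, A.indicator (fun ω => g (ω n j)) ω ∂(tableLaw E μ) =
      (tableLaw E μ).real A * ∫ x, g x ∂(E.law (μ j)) := by
  have hA' : MeasurableSet A := S.obsSigma_le n _ hA
  have hgm : Measurable (fun ω : Table K => g (ω n j)) :=
    hg.comp (measurePreserving_entry E μ n j).measurable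
  have hind : IndepFun (A.indicator (1 : Table K → ℝ)) (fun ω => g (ω n j)) (tableLaw E μ) := by
    refine indep_of_indep_of_le_right (indep_of_indep_of_le_left (S.indep_obsSigma E μ n) ?_) ?_
    · exact (Measurable.indicator (@measurable_const _ _ _ (obsSigma S.arm n) 1) hA).comap_le
    · exact (Measurable.comp (g := fun r : Fin K → ℝ => g (r j))
        (hg.comp (measurable_pi_apply j)) (comap_measurable (fun ω : Table K => ω n))).comap_le
  have h := hind.integral_fun_mul_eq_mul_integral
    (measurable_one.indicator hA').aestronglyMeasurable hgm.aestronglyMeasurable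
  rw [integral_indicator_one hA'] at h
  rw [← (measurePreserving_entry E μ n j).map_eq,
    integral_map (measurePreserving_entry E μ n j).measurable.aemeasurable
      hg.aestronglyMeasurable]
  rw [← h]
  refine integral_congr_ae (ae_of_all _ fun ω => ?_)
  by_cases hω : ω ∈ A <;> simp [hω]

end SamplingStrategy

/-- The log-likelihood ratio of a measurement of slice `j`. -/
def armLlr (μ ν : Fin K → E.means) (j : Fin K) : ℝ → ℝ := llr (E.law (μ j)) (E.law (ν j))

theorem measurable_armLlr (μ ν : Fin K → E.means) (j : Fin K) : Measurable (armLlr E μ ν j) :=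
  measurable_llr _ _

/-- The likelihood ratio of `ν` with respect to `μ` for a measurement of slice `j`. -/
def armRatio (μ ν : Fin K → E.means) (j : Fin K) (x : ℝ) : ℝ≥0∞ :=
  ENNReal.ofReal (Real.exp (-armLlr E μ ν j x))

theorem measurable_armRatio (μ ν : Fin K → E.means) (j : Fin K) : Measurable (armRatio E μ ν j) :=
  (measurable_armLlr E μ ν j).neg.exp.ennreal_ofReal

/-- The members are mutually absolutely continuous, so `exp (-llr)` is the density of the law under
`ν` with respect to the law under `μ`. -/
theorem setLIntegral_armRatio (μ ν : Fin K → E.means) (j : Fin K) (C : Set ℝ) :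
    ∫⁻ x in C, armRatio E μ ν j x ∂(E.law (μ j)) = E.law (ν j) C := by
  rw [← Measure.setLIntegral_rnDeriv (E.law_absolutelyContinuous (ν j) (μ j)) C]
  refine lintegral_congr_ae (ae_restrict_of_ae ?_)
  filter_upwards [exp_neg_llr (E.law_absolutelyContinuous (μ j) (ν j)),
    Measure.rnDeriv_lt_top (E.law (ν j)) (E.law (μ j))] with x hx hx'
  rw [armRatio, armLlr, hx, ENNReal.ofReal_toReal hx'.ne]

/-- The log-likelihood ratio of the measurement made in slot `s + 1`. -/
def slotLlr (S : SamplingStrategy K) (μ ν : Fin K → E.means) (s : ℕ) (ω : Table K) : ℝ :=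
  armLlr E μ ν (S.arm s ω) (ω s (S.arm s ω))

/-- The likelihood ratio of the measurement made in slot `s + 1`. -/
def slotRatio (S : SamplingStrategy K) (μ ν : Fin K → E.means) (s : ℕ) (ω : Table K) : ℝ≥0∞ :=
  armRatio E μ ν (S.arm s ω) (ω s (S.arm s ω))

/-- The likelihood ratio of the first `n` observations. -/
def likelihoodRatio (S : SamplingStrategy K) (μ ν : Fin K → E.means) (n : ℕ) (ω : Table K) :
    ℝ≥0∞ :=
  ∏ s ∈ Finset.range n, slotRatio E S μ ν s ω

namespace SamplingStrategy

variable (S : SamplingStrategy K) (μ ν : Fin K → E.means)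

theorem measurable_slotRatio (s : ℕ) :
    Measurable[obsSigma S.arm (s + 1)] (slotRatio E S μ ν s) := by
  unfold slotRatio
  have h : Measurable (fun p : Fin K × ℝ => armRatio E μ ν p.1 p.2) :=
    measurable_from_prod_countable_right fun k => measurable_armRatio E μ ν k
  have h' := h.comp (S.measurable_observation s)
  exact h'

theorem measurable_likelihoodRatio (n : ℕ) :
    Measurable[obsSigma S.arm n] (likelihoodRatio E S μ ν n) := by
  refine Finset.measurable_fun_prod _ fun s hs => ?_
  exact (S.measurable_slotRatio E μ ν s).mono
    (S.obsSigma_mono (Finset.mem_range.1 hs)) le_rfl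

theorem measurableSet_arm_eq (n : ℕ) (j : Fin K) :
    MeasurableSet[obsSigma S.arm n] {ω | S.arm n ω = j} :=
  S.measurable_arm n (measurableSet_singleton j)

/-- Once the event is split according to the slice probed, the new factor is a function of a fixed
entry of the fresh row. It is integrated separately and turns the law of that entry under `μ` into
its law under `ν`. Under `ν` itself, `tableLaw_inter_observation` gives the same decomposition. -/
theorem setLIntegral_likelihoodRatio_succ (n : ℕ) {A : Set (Table K)}
    (hA : MeasurableSet[obsSigma S.arm n] A) {C : Set (Fin K × ℝ)} (hC : MeasurableSet C) :
    ∫⁻ ω in A ∩ (fun ω : Table K => (S.arm n ω, ω n (S.arm n ω))) ⁻¹' C,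
        likelihoodRatio E S μ ν (n + 1) ω ∂(tableLaw E μ) =
      ∑ j, (∫⁻ ω in A ∩ {ω | S.arm n ω = j}, likelihoodRatio E S μ ν n ω ∂(tableLaw E μ)) *
        E.law (ν j) (Prod.mk j ⁻¹' C) := by
  have hobs := ((S.measurable_observation n).mono (S.obsSigma_le (n + 1)) le_rfl) hC
  have hAj : ∀ j, MeasurableSet[obsSigma S.arm n] (A ∩ {ω | S.arm n ω = j}) :=
    fun j => hA.inter (S.measurableSet_arm_eq n j)
  have hterm : ∀ j, (∫⁻ ω in A ∩ {ω | S.arm n ω = j},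
      likelihoodRatio E S μ ν n ω ∂(tableLaw E μ)) * E.law (ν j) (Prod.mk j ⁻¹' C) =
      ∫⁻ ω, (A ∩ {ω | S.arm n ω = j}).indicator (likelihoodRatio E S μ ν n) ω *
        (Prod.mk j ⁻¹' C).indicator (armRatio E μ ν j) (ω n j) ∂(tableLaw E μ) := by
    intro j
    have hCj : MeasurableSet (Prod.mk j ⁻¹' C) := measurable_prodMk_left hC
    rw [S.lintegral_mul_entry E μ n j
      ((S.measurable_likelihoodRatio E μ ν n).indicator (hAj j))
      ((measurable_armRatio E μ ν j).indicator hCj), lintegral_indicator hCj,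
      setLIntegral_armRatio, lintegral_indicator (S.obsSigma_le n _ (hAj j))]
  simp_rw [hterm]
  rw [← lintegral_indicator ((S.obsSigma_le n _ hA).inter hobs), ← lintegral_finsetSum]
  · refine lintegral_congr fun ω => ?_
    rw [Finset.sum_eq_single (S.arm n ω)]
    · by_cases h1 : ω ∈ A <;> by_cases h2 : (S.arm n ω, ω n (S.arm n ω)) ∈ C <;>
        simp [indicator, h1, h2, likelihoodRatio, Finset.prod_range_succ, slotRatio]
    · intro j _ hj
      simp [indicator, hj.symm]
    · simp
  · intro j _
    refine Measurable.mul ?_ ?_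
    · exact ((S.measurable_likelihoodRatio E μ ν n).indicator (hAj j)).mono
        (S.obsSigma_le n) le_rfl
    · exact ((measurable_armRatio E μ ν j).indicator (measurable_prodMk_left hC)).comp
        (measurePreserving_entry E μ n j).measurable

theorem tableLaw_inter_observation (n : ℕ) {A : Set (Table K)}
    (hA : MeasurableSet[obsSigma S.arm n] A) {C : Set (Fin K × ℝ)} (hC : MeasurableSet C) :
    tableLaw E ν (A ∩ (fun ω : Table K => (S.arm n ω, ω n (S.arm n ω))) ⁻¹' C) =
      ∑ j, tableLaw E ν (A ∩ {ω | S.arm n ω = j}) * E.law (ν j) (Prod.mk j ⁻¹' C) := by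
  have hobs := ((S.measurable_observation n).mono (S.obsSigma_le (n + 1)) le_rfl) hC
  have hAj : ∀ j, MeasurableSet[obsSigma S.arm n] (A ∩ {ω | S.arm n ω = j}) :=
    fun j => hA.inter (S.measurableSet_arm_eq n j)
  have hterm : ∀ j, tableLaw E ν (A ∩ {ω | S.arm n ω = j}) * E.law (ν j) (Prod.mk j ⁻¹' C) =
      ∫⁻ ω, (A ∩ {ω | S.arm n ω = j}).indicator 1 ω *
        (Prod.mk j ⁻¹' C).indicator (1 : ℝ → ℝ≥0∞) (ω n j) ∂(tableLaw E ν) := by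
    intro j
    have hCj : MeasurableSet (Prod.mk j ⁻¹' C) := measurable_prodMk_left hC
    rw [S.lintegral_mul_entry E ν n j (f := (A ∩ {ω | S.arm n ω = j}).indicator 1)
      (Measurable.indicator (@measurable_const _ _ _ (obsSigma S.arm n) 1) (hAj j))
      (measurable_one.indicator hCj), lintegral_indicator_one hCj,
      lintegral_indicator_one (S.obsSigma_le n _ (hAj j))]
  simp_rw [hterm]
  rw [← lintegral_indicator_one ((S.obsSigma_le n _ hA).inter hobs), ← lintegral_finsetSum]
  · refine lintegral_congr fun ω => ?_
    rw [Finset.sum_eq_single (S.arm n ω)]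
    · by_cases h1 : ω ∈ A <;> by_cases h2 : (S.arm n ω, ω n (S.arm n ω)) ∈ C <;>
        simp [indicator, h1, h2]
    · intro j _ hj
      simp [indicator, hj.symm]
    · simp
  · intro j _
    refine Measurable.mul ?_ ?_
    · exact measurable_one.indicator (S.obsSigma_le n _ (hAj j))
    · exact (measurable_one.indicator (measurable_prodMk_left hC)).comp
        (measurePreserving_entry E ν n j).measurable

/-- Change of measure on the observations made before a fixed time. -/
theorem setLIntegral_likelihoodRatio (n : ℕ) {B : Set (Table K)}
    (hB : MeasurableSet[obsSigma S.arm n] B) :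
    ∫⁻ ω in B, likelihoodRatio E S μ ν n ω ∂(tableLaw E μ) = tableLaw E ν B := by
  induction n generalizing B with
  | zero =>
    have hbot : obsSigma S.arm 0 = ⊥ :=
      eq_bot_iff.2 (iSup₂_le fun s hs => absurd hs (Nat.not_lt_zero s))
    rw [hbot] at hB
    rcases MeasurableSpace.measurableSet_bot_iff.1 hB with rfl | rfl <;>
      simp [likelihoodRatio]
  | succ n ih =>
    have hrect : ∀ A, MeasurableSet[obsSigma S.arm n] A → ∀ C : Set (Fin K × ℝ),
        MeasurableSet C →
        tableLaw E ν (A ∩ (fun ω : Table K => (S.arm n ω, ω n (S.arm n ω))) ⁻¹' C) =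
        (tableLaw E μ).withDensity (likelihoodRatio E S μ ν (n + 1))
          (A ∩ (fun ω : Table K => (S.arm n ω, ω n (S.arm n ω))) ⁻¹' C) := by
      intro A hA C hC
      rw [withDensity_apply _ ((S.obsSigma_le n _ hA).inter
        (((S.measurable_observation n).mono (S.obsSigma_le (n + 1)) le_rfl) hC)),
        S.setLIntegral_likelihoodRatio_succ E μ ν n hA hC,
        S.tableLaw_inter_observation E ν n hA hC]
      exact Finset.sum_congr rfl fun j _ => by rw [ih (hA.inter (S.measurableSet_arm_eq n j))]
    rw [← withDensity_apply _ (S.obsSigma_le _ _ hB)]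
    symm
    -- Past events intersected with events of the new observation form a π-system generating the
    -- next σ-algebra, so agreement on them suffices.
    refine ext_on_measurableSpace_of_generate_finite _
      {s | ∃ A, MeasurableSet[obsSigma S.arm n] A ∧ ∃ C : Set (Fin K × ℝ), MeasurableSet C ∧
        A ∩ (fun ω : Table K => (S.arm n ω, ω n (S.arm n ω))) ⁻¹' C = s}
      ?_ (S.obsSigma_le (n + 1)) ?_ ?_ ?_ hB
    · rintro _ ⟨A, hA, C, hC, rfl⟩
      exact hrect A hA C hC
    · rw [S.obsSigma_succ]
      apply le_antisymm
      · refine sup_le (fun A hA => ?_) ?_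
        · exact MeasurableSpace.measurableSet_generateFrom ⟨A, hA, univ, .univ, by simp⟩
        · rintro _ ⟨C, hC, rfl⟩
          exact MeasurableSpace.measurableSet_generateFrom ⟨univ, .univ, C, hC, by simp⟩
      · refine MeasurableSpace.generateFrom_le ?_
        rintro _ ⟨A, hA, C, hC, rfl⟩
        exact MeasurableSet.inter (le_sup_left (a := obsSigma S.arm n) _ hA)
          (le_sup_right (a := obsSigma S.arm n) _ ⟨C, hC, rfl⟩)
    · rintro _ ⟨A, hA, C, hC, rfl⟩ _ ⟨A', hA', C', hC', rfl⟩ _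
      refine ⟨A ∩ A', hA.inter hA', C ∩ C', hC.inter hC', ?_⟩
      rw [preimage_inter, inter_inter_inter_comm]
    · simpa using hrect univ .univ univ .univ

end SamplingStrategy

end AdmissionControl

/-! ### Stopping times, Wald's identity and the transportation inequality -/

namespace AdmissionControl

open Filter Topology

variable {K : ℕ} (E : ExpFamily)

/-- The log-likelihood ratio of the observations made before `min n (τ ω)`. -/
def stoppedLlr (S : SamplingStrategy K) (μ ν : Fin K → E.means) (τ : Table K → WithTop ℕ) (n : ℕ)
    (ω : Table K) : ℝ :=
  ∑ s ∈ Finset.range n, if (s : WithTop ℕ) < τ ω then slotLlr E S μ ν s ω else 0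

/-- The likelihood ratio of the observations made before `min n (τ ω)`. -/
def stoppedRatio (S : SamplingStrategy K) (μ ν : Fin K → E.means) (τ : Table K → WithTop ℕ)
    (n : ℕ) (ω : Table K) : ℝ≥0∞ :=
  ∏ s ∈ Finset.range n, if (s : WithTop ℕ) < τ ω then slotRatio E S μ ν s ω else 1

theorem stoppedRatio_eq_ofReal_exp (S : SamplingStrategy K) (μ ν : Fin K → E.means)
    (τ : Table K → WithTop ℕ) (n : ℕ) (ω : Table K) :
    stoppedRatio E S μ ν τ n ω = ENNReal.ofReal (Real.exp (-stoppedLlr E S μ ν τ n ω)) := by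
  rw [stoppedRatio, stoppedLlr, ← Finset.sum_neg_distrib, Real.exp_sum,
    ENNReal.ofReal_prod_of_nonneg fun _ _ => (Real.exp_pos _).le]
  refine Finset.prod_congr rfl fun s _ => ?_
  split_ifs
  · rfl
  · simp

namespace SamplingStrategy

variable (S : SamplingStrategy K) (μ ν : Fin K → E.means) {τ : Table K → WithTop ℕ}


theorem measurableSet_le_time (hτ : IsStoppingTime S.filtration τ) (s : ℕ) : MeasurableSet[obsSigma S.arm s] {ω | τ ω ≤ s} := hτ s

theorem measurableSet_lt_time (hτ : IsStoppingTime S.filtration τ) (s : ℕ) :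
    MeasurableSet[obsSigma S.arm s] {ω | (s : WithTop ℕ) < τ ω} := by
  have h := (S.measurableSet_le_time hτ s).compl
  simpa only [compl_ofPred, not_le] using h

theorem measurableSet_probed (hτ : IsStoppingTime S.filtration τ) (s : ℕ) (j : Fin K) :
    MeasurableSet[obsSigma S.arm s] {ω | (s : WithTop ℕ) < τ ω ∧ S.arm s ω = j} :=
  (S.measurableSet_lt_time hτ s).inter (S.measurableSet_arm_eq s j)

/-- Change of measure on the observations made before a stopping time. -/
theorem setLIntegral_stoppedRatio (hτ : IsStoppingTime S.filtration τ) (n : ℕ) {D : Set (Table K)}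
    (hD : MeasurableSet[obsSigma S.arm n] D)
    (hDτ : ∀ m < n, MeasurableSet[obsSigma S.arm m] (D ∩ {ω | τ ω ≤ m})) :
    ∫⁻ ω in D, stoppedRatio E S μ ν τ n ω ∂(tableLaw E μ) = tableLaw E ν D := by
  induction n generalizing D with
  | zero =>
    have h := S.setLIntegral_likelihoodRatio E μ ν 0 hD
    simpa [stoppedRatio, likelihoodRatio] using h
  | succ n ih =>
    have hle := S.measurableSet_le_time hτ n
    have hle' := S.obsSigma_le n _ hle
    have hin := hDτ n n.lt_succ_self
    -- The hypotheses say that `D` belongs to the σ-algebra at time `min n τ`. On `τ ≤ n` the last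
    -- factor is `1` and the induction hypothesis applies; on `n < τ` no factor has been frozen, so
    -- the fixed-time formula applies.
    rw [← lintegral_inter_add_sdiff _ D hle', ← measure_inter_add_sdiff D hle']
    congr 1
    · rw [← ih hin fun m hm => ?_]
      · refine setLIntegral_congr_fun (S.obsSigma_le n _ hin) fun ω hω => ?_
        have h : ¬ (n : WithTop ℕ) < τ ω := not_lt.2 hω.2
        simp only [stoppedRatio, Finset.prod_range_succ, if_neg h, mul_one]
      · have h : D ∩ {ω | τ ω ≤ n} ∩ {ω | τ ω ≤ m} = D ∩ {ω | τ ω ≤ m} := by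
          ext ω
          simp only [mem_inter_iff, mem_ofPred_eq]
          have : τ ω ≤ m → τ ω ≤ n := fun h => h.trans (by exact_mod_cast hm.le)
          tauto
        rw [h]
        exact hDτ m (hm.trans n.lt_succ_self)
    · have hdiff : MeasurableSet[obsSigma S.arm (n + 1)] (D \ {ω | τ ω ≤ n}) :=
        hD.diff (S.obsSigma_mono n.le_succ _ hle)
      rw [← S.setLIntegral_likelihoodRatio E μ ν (n + 1) hdiff]
      refine setLIntegral_congr_fun (S.obsSigma_le _ _ hdiff) fun ω hω => ?_
      refine Finset.prod_congr rfl fun s hs => if_pos ?_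
      have h1 : (n : WithTop ℕ) < τ ω := not_le.1 hω.2
      exact lt_of_le_of_lt (by exact_mod_cast Nat.lt_succ_iff.1 (Finset.mem_range.1 hs)) h1

/-- Each term pairs an event decided by the first `s` observations with an entry of the fresh row
`s`; expectations then factor, which is what Wald's identity needs. -/
theorem stoppedLlr_eq_sum_indicator (n : ℕ) (ω : Table K) :
    stoppedLlr E S μ ν τ n ω = ∑ s ∈ Finset.range n, ∑ j,
      {ω | (s : WithTop ℕ) < τ ω ∧ S.arm s ω = j}.indicator
        (fun ω => armLlr E μ ν j (ω s j)) ω := by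
  refine Finset.sum_congr rfl fun s _ => ?_
  rw [Finset.sum_eq_single (S.arm s ω)]
  · simp [indicator, slotLlr]
  · intro j _ hj
    simp [indicator, hj.symm]
  · simp

theorem integrable_indicator_armLlr (hτ : IsStoppingTime S.filtration τ) (s : ℕ) (j : Fin K) :
    Integrable ({ω | (s : WithTop ℕ) < τ ω ∧ S.arm s ω = j}.indicator
      (fun ω => armLlr E μ ν j (ω s j))) (tableLaw E μ) :=
  ((measurePreserving_entry E μ s j).integrable_comp_of_integrable
    (E.integrable_llr_law (μ j) (ν j))).indicator
      (S.obsSigma_le s _ (S.measurableSet_probed hτ s j))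

theorem integrable_stoppedLlr (hτ : IsStoppingTime S.filtration τ) (n : ℕ) :
    Integrable (stoppedLlr E S μ ν τ n) (tableLaw E μ) := by
  refine Integrable.congr ?_
    (ae_of_all _ fun ω => (S.stoppedLlr_eq_sum_indicator E μ ν n ω).symm)
  exact integrable_finsetSum _ fun s _ => integrable_finsetSum _ fun j _ =>
    S.integrable_indicator_armLlr E μ ν hτ s j

/-- Wald's identity for the log-likelihood ratio. -/
theorem integral_stoppedLlr (hτ : IsStoppingTime S.filtration τ) (n : ℕ) :
    ∫ ω, stoppedLlr E S μ ν τ n ω ∂(tableLaw E μ) = ∑ s ∈ Finset.range n, ∑ j,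
      (tableLaw E μ).real {ω | (s : WithTop ℕ) < τ ω ∧ S.arm s ω = j} *
        (E.d (μ j) (ν j)).toReal := by
  simp_rw [stoppedLlr_eq_sum_indicator]
  rw [integral_finsetSum _ fun s _ => integrable_finsetSum _ fun j _ =>
    S.integrable_indicator_armLlr E μ ν hτ s j]
  refine Finset.sum_congr rfl fun s _ => ?_
  rw [integral_finsetSum _ fun j _ => S.integrable_indicator_armLlr E μ ν hτ s j]
  refine Finset.sum_congr rfl fun j _ => ?_
  rw [S.integral_indicator_entry E μ s j (S.measurableSet_probed hτ s j)
    (measurable_armLlr E μ ν j), E.toReal_d_eq_integral_llr]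
  rfl

/-- The transportation inequality: an event that has probability at most `δ` under `ν` can be
likely under `μ` only if enough information has been collected before the stopping time. -/
theorem mul_log_le_sum_probed (hτ : IsStoppingTime S.filtration τ) {δ : ℝ} (hδ : 0 < δ) (hδ' : δ ≤ 1 / 2) (n : ℕ) {D : Set (Table K)}
    (hD : MeasurableSet[obsSigma S.arm n] D)
    (hDτ : ∀ m < n, MeasurableSet[obsSigma S.arm m] (D ∩ {ω | τ ω ≤ m}))
    (hν : (tableLaw E ν).real D ≤ δ) :
    (2 * (tableLaw E μ).real D - 1) * Real.log ((1 - δ) / δ) ≤ ∑ s ∈ Finset.range n, ∑ j,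
      (tableLaw E μ).real {ω | (s : WithTop ℕ) < τ ω ∧ S.arm s ω = j} *
        (E.d (μ j) (ν j)).toReal := by
  classical
  have hpos : 0 < 1 - δ := by linarith
  set c := Real.log ((1 - δ) / δ) with hc
  have hexp : Real.exp c = (1 - δ) / δ := Real.exp_log (by positivity)
  have hexp' : Real.exp (-c) = δ / (1 - δ) := by rw [Real.exp_neg, hexp, inv_div]
  have hDm := S.obsSigma_le n _ hD
  set L := stoppedLlr E S μ ν τ n with hL
  -- The test function equals `c` on `D` and `-c` off `D`: it is the log-likelihood ratio of
  -- Bernoulli `1 - δ` against Bernoulli `δ`, evaluated at the indicator of `D`.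
  set f : Table K → ℝ := fun ω => D.indicator (fun _ => 2 * c) ω - c with hf
  have hfint : Integrable f (tableLaw E μ) :=
    ((integrable_const _).indicator hDm).sub (integrable_const _)
  have hLint : Integrable L (tableLaw E μ) := S.integrable_stoppedLlr E μ ν hτ n
  have hintf : ∫ ω, f ω ∂(tableLaw E μ) = (2 * (tableLaw E μ).real D - 1) * c := by
    rw [hf, integral_sub ((integrable_const _).indicator hDm) (integrable_const _),
      integral_indicator_const _ hDm]
    simp
    ring
  have hcompl : ∀ m < n, MeasurableSet[obsSigma S.arm m] (Dᶜ ∩ {ω | τ ω ≤ m}) := by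
    intro m hm
    have h : Dᶜ ∩ {ω | τ ω ≤ m} = {ω | τ ω ≤ m} \ (D ∩ {ω | τ ω ≤ m}) := by
      ext ω
      simp only [mem_inter_iff, Set.mem_sdiff, mem_compl_iff]
      tauto
    rw [h]
    exact (S.measurableSet_le_time hτ m).diff (hDτ m hm)
  -- The factor `exp (-L)` changes `μ` into `ν`, so the integral is `exp c * q + exp (-c) * (1 - q)`
  -- with `q` the probability of `D` under `ν`.
  have hlint : ∫⁻ ω, ENNReal.ofReal (Real.exp (f ω - L ω)) ∂(tableLaw E μ) ≤ 1 := by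
    rw [← lintegral_add_compl _ hDm]
    have h1 : ∫⁻ ω in D, ENNReal.ofReal (Real.exp (f ω - L ω)) ∂(tableLaw E μ) =
        ENNReal.ofReal ((1 - δ) / δ) * tableLaw E ν D := by
      rw [← S.setLIntegral_stoppedRatio E μ ν hτ n hD hDτ,
        ← lintegral_const_mul' _ _ ENNReal.ofReal_ne_top]
      refine setLIntegral_congr_fun hDm fun ω hω => ?_
      rw [stoppedRatio_eq_ofReal_exp, ← ENNReal.ofReal_mul (by positivity), ← hexp, ← Real.exp_add]
      simp only [hf, indicator_of_mem hω]
      congr 2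
      ring
    have h2 : ∫⁻ ω in Dᶜ, ENNReal.ofReal (Real.exp (f ω - L ω)) ∂(tableLaw E μ) =
        ENNReal.ofReal (δ / (1 - δ)) * tableLaw E ν Dᶜ := by
      rw [← S.setLIntegral_stoppedRatio E μ ν hτ n hD.compl hcompl,
        ← lintegral_const_mul' _ _ ENNReal.ofReal_ne_top]
      refine setLIntegral_congr_fun hDm.compl fun ω hω => ?_
      rw [stoppedRatio_eq_ofReal_exp, ← ENNReal.ofReal_mul (by positivity), ← hexp',
        ← Real.exp_add]
      simp only [hf, indicator_of_notMem hω]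
      congr 2
      ring
    rw [h1, h2, ← ofReal_measureReal, ← ofReal_measureReal, probReal_compl_eq_one_sub hDm,
      ← ENNReal.ofReal_mul (by positivity), ← ENNReal.ofReal_mul (by positivity),
      ← ENNReal.ofReal_add (by positivity)
        (mul_nonneg (by positivity) (sub_nonneg.2 measureReal_le_one)), ENNReal.ofReal_le_one]
    -- As `δ ≤ 1 / 2`, the expression is nondecreasing in `q`; since `q ≤ δ`, it is at most its
    -- value at `δ`, which is `1` by `h4`.
    have h3 : δ / (1 - δ) ≤ (1 - δ) / δ := by
      rw [div_le_div_iff₀ hpos hδ]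
      nlinarith
    have h4 : (1 - δ) / δ * δ + δ / (1 - δ) * (1 - δ) = 1 := by
      field_simp
      ring
    nlinarith
  have hexpm : AEStronglyMeasurable (fun ω => Real.exp (f ω - L ω)) (tableLaw E μ) :=
    Real.continuous_exp.comp_aestronglyMeasurable (hfint.sub hLint).aestronglyMeasurable
  have hexpint : Integrable (fun ω => Real.exp (f ω - L ω)) (tableLaw E μ) := by
    refine ⟨hexpm, ?_⟩
    rw [hasFiniteIntegral_iff_ofReal (ae_of_all _ fun ω => (Real.exp_pos _).le)]
    exact hlint.trans_lt ENNReal.one_lt_top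
  have hle : ∫ ω, Real.exp (f ω - L ω) ∂(tableLaw E μ) ≤ 1 := by
    rw [integral_eq_lintegral_of_nonneg_ae (ae_of_all _ fun ω => (Real.exp_pos _).le) hexpm]
    exact ENNReal.toReal_mono ENNReal.one_ne_top hlint
  have hsub : Integrable (fun ω => f ω - L ω) (tableLaw E μ) := hfint.sub hLint
  -- Integrating `x + 1 ≤ exp x` at `x = f - L` gives that the mean of `f` is at most the mean of
  -- `L`.
  have hmono : ∫ ω, (f ω - L ω + 1) ∂(tableLaw E μ) ≤
      ∫ ω, Real.exp (f ω - L ω) ∂(tableLaw E μ) :=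
    integral_mono (hsub.add (integrable_const _)) hexpint
      fun ω => Real.add_one_le_exp _
  rw [integral_add hsub (integrable_const _), integral_sub hfint hLint, hintf,
    S.integral_stoppedLlr E μ ν hτ n] at hmono
  simp only [integral_const, probReal_univ, smul_eq_mul, mul_one] at hmono
  linarith

end SamplingStrategy

end AdmissionControl

namespace AdmissionControl

open Filter Topology

/-! ### The Bernoulli divergence in closed form -/

section Bernoulli

open InformationTheory

theorem bernoulliMeasure_eq_withDensity {p q : unitInterval} (h0 : 0 < (q : ℝ)) (h1 : (q : ℝ) < 1) :
    bernoulliMeasure (1 : ℝ) 0 p = (bernoulliMeasure (1 : ℝ) 0 q).withDensity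
      (fun x => ENNReal.ofReal (if x = 1 then (p : ℝ) / q else (1 - p) / (1 - q))) := by
  have hm : Measurable
      (fun x : ℝ => ENNReal.ofReal (if x = 1 then (p : ℝ) / q else (1 - p) / (1 - q))) :=
    (Measurable.ite (measurableSet_singleton 1) measurable_const measurable_const).ennreal_ofReal
  have hcoe : ∀ r : unitInterval, ((unitInterval.toNNReal r : NNReal) : ℝ≥0∞) =
      ENNReal.ofReal r := fun r => by
    rw [← ENNReal.ofReal_coe_nnreal]; rfl
  ext s hs
  rw [withDensity_apply _ hs, ← lintegral_indicator hs, bernoulliMeasure_def, bernoulliMeasure_def,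
    lintegral_add_measure]
  simp only [Measure.add_apply, Measure.smul_apply, lintegral_smul_measure,
    lintegral_dirac' _ (hm.indicator hs), Measure.dirac_apply' _ hs, ENNReal.smul_def,
    smul_eq_mul, hcoe]
  by_cases hs1 : (1 : ℝ) ∈ s <;> by_cases hs0 : (0 : ℝ) ∈ s <;>
    simp [hs1, hs0, ← ENNReal.ofReal_mul h0.le, ← ENNReal.ofReal_mul (sub_nonneg.2 h1.le),
      mul_div_cancel₀ _ h0.ne', mul_div_cancel₀ _ (sub_pos.2 h1).ne']

theorem dB_symm (δ : unitInterval) (h0 : 0 < (δ : ℝ)) (h1 : (δ : ℝ) < 1) :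
    dB δ (unitInterval.symm δ) =
      ENNReal.ofReal ((1 - 2 * δ) * Real.log ((1 - δ) / δ)) := by
  set q := unitInterval.symm δ with hq
  have hqv : (q : ℝ) = 1 - δ := rfl
  have h := bernoulliMeasure_eq_withDensity (p := δ) (q := q) (by linarith) (by linarith)
  set g : ℝ → ℝ≥0∞ :=
    fun x => ENNReal.ofReal (if x = 1 then (δ : ℝ) / q else (1 - δ) / (1 - q)) with hg
  have hm : Measurable g :=
    (Measurable.ite (measurableSet_singleton 1) measurable_const measurable_const).ennreal_ofReal
  have hac : bernoulliMeasure (1 : ℝ) 0 δ ≪ bernoulliMeasure (1 : ℝ) 0 q := by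
    rw [h]; exact withDensity_absolutelyContinuous _ _
  have hllr : llr (bernoulliMeasure (1 : ℝ) 0 δ) (bernoulliMeasure (1 : ℝ) 0 q)
      =ᵐ[bernoulliMeasure (1 : ℝ) 0 δ] fun x => Real.log (g x).toReal := by
    apply hac.ae_le
    have := Measure.rnDeriv_withDensity (bernoulliMeasure (1 : ℝ) 0 q) hm
    rw [← h] at this
    filter_upwards [this] with x hx
    rw [llr, hx]
  have hint : Integrable (fun x => Real.log (g x).toReal) (bernoulliMeasure (1 : ℝ) 0 δ) := by
    rw [bernoulliMeasure_def]
    exact ((integrable_dirac (by simp)).smul_measure_nnreal).add_measure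
      ((integrable_dirac (by simp)).smul_measure_nnreal)
  rw [dB, klDiv_of_ac_of_integrable hac (hint.congr hllr.symm), integral_congr_ae hllr,
    integral_bernoulliMeasure]
  have hδ : 0 < 1 - (δ : ℝ) := by linarith
  have e1 : (g 1).toReal = ((1 - (δ : ℝ)) / δ)⁻¹ := by
    simp only [hg, if_true, hqv]
    rw [ENNReal.toReal_ofReal (by positivity), inv_div]
  have e0 : (g 0).toReal = (1 - (δ : ℝ)) / δ := by
    simp only [hg, zero_ne_one, if_false, hqv, sub_sub_cancel]
    rw [ENNReal.toReal_ofReal (by positivity)]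
  rw [e1, e0, Real.log_inv]
  simp only [probReal_univ, smul_eq_mul]
  congr 1
  ring

end Bernoulli

/-! ### Rejection and identifiability for the three criteria -/

section CorrectAnswers

variable {K : ℕ} [NeZero K] {α : Type*} [LinearOrder α] {γ : α}

theorem minLoad_lt_iff {μ : Fin K → α} : minLoad μ < γ ↔ ∃ k, μ k < γ := by
  simp [minLoad, Finset.inf'_lt_iff]

theorem minLoad_le (μ : Fin K → α) (k : Fin K) : minLoad μ ≤ μ k :=
  Finset.inf'_le _ (Finset.mem_univ k)

theorem zero_mem_correctAnswers_iff {c : Criterion} {μ : Fin K → α} :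
    0 ∈ correctAnswers c γ μ ↔ ∀ k, γ ≤ μ k := by
  have h : (∀ k, γ ≤ μ k) ↔ ¬ minLoad μ < γ := by simp [minLoad_lt_iff]
  rw [h]
  by_cases hlt : minLoad μ < γ
  · cases c <;> simp [correctAnswers, hlt]
  · simp [correctAnswers, hlt]

theorem identifiable_of_forall_lt (c : Criterion) {μ : Fin K → α} (h : ∀ k, γ < μ k)
    (hmin : minLoad μ ≠ γ) : Identifiable c γ μ := by
  have hnot : ¬ minLoad μ < γ := by
    rw [minLoad_lt_iff]
    rintro ⟨k, hk⟩
    exact lt_asymm hk (h k)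
  cases c
  · exact hmin
  · exact ⟨fun k => (h k).ne', by simp [correctAnswers, hnot]⟩
  · exact ⟨hmin, by simp [correctAnswers, hnot]⟩

/-- Slice `k` is the only one below `γ`, so it is at once the only available, the packing and the
least loaded slice. -/
theorem identifiable_update (c : Criterion) {μ : Fin K → α} (h : ∀ k, γ < μ k) (k : Fin K) {b : α}
    (hb : b < γ) : Identifiable c γ (Function.update μ k b) := by
  have hlt : minLoad (Function.update μ k b) < γ := minLoad_lt_iff.2 ⟨k, by simpa using hb⟩
  have huniq : ∀ j, Function.update μ k b j < γ → j = k := by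
    intro j hj
    by_contra hne
    rw [Function.update_of_ne hne] at hj
    exact lt_asymm hj (h j)
  cases c
  · exact hlt.ne
  · refine ⟨fun j => ?_, ?_⟩
    · by_cases hj : j = k
      · subst hj
        simpa using hb.ne
      · rw [Function.update_of_ne hj]
        exact (h j).ne'
    · rw [correctAnswers, if_pos hlt]
      rintro _ ⟨i, hi, rfl⟩ _ ⟨j, hj, rfl⟩
      rw [huniq i hi.1, huniq j hj.1]
  · refine ⟨hlt.ne, ?_⟩
    rw [correctAnswers, if_pos hlt]
    rintro _ ⟨i, hi, rfl⟩ _ ⟨j, hj, rfl⟩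
    rw [huniq i (lt_of_eq_of_lt hi hlt), huniq j (lt_of_eq_of_lt hj hlt)]

end CorrectAnswers

/-! ### Lower bound on the expected cost -/

section LowerBound

variable {K : ℕ} (E : ExpFamily)

/-- The expected number of measurements of slice `k`. -/
def expectedProbes (A : Algorithm K) (μ : Fin K → E.means) (k : Fin K) : ℝ≥0∞ :=
  ∑' s : ℕ, tableLaw E μ {ω | (s : WithTop ℕ) < A.τ ω ∧ A.arm s ω = k}

/-- Exactly one slice is probed in each slot before `τ`, so the total count over slots and slices is
at most `τ`. -/
theorem sum_expectedProbes_le (A : Algorithm K) (μ : Fin K → E.means) :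
    ∑ k, expectedProbes E A μ k ≤ A.expectedCost E μ := by
  have hmeas : ∀ (s : ℕ) k, MeasurableSet {ω | (s : WithTop ℕ) < A.τ ω ∧ A.arm s ω = k} :=
    fun s k => A.obsSigma_le s _ (A.measurableSet_probed A.isStoppingTime s k)
  have h : ∀ k, expectedProbes E A μ k = ∫⁻ ω, ∑' s : ℕ,
      {ω | (s : WithTop ℕ) < A.τ ω ∧ A.arm s ω = k}.indicator 1 ω ∂(tableLaw E μ) := by
    intro k
    rw [lintegral_tsum fun s => (measurable_one.indicator (hmeas s k)).aemeasurable]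
    simp only [lintegral_indicator_one (hmeas _ k), expectedProbes]
  simp only [h]
  rw [← lintegral_finsetSum _ fun k _ =>
    Measurable.tsum fun s => measurable_one.indicator (hmeas s k), Algorithm.expectedCost]
  refine lintegral_mono fun ω => ?_
  rw [← Summable.tsum_finsetSum fun _ _ => ENNReal.summable]
  have hs : ∀ s : ℕ, ∑ k, ({ω | (s : WithTop ℕ) < A.τ ω ∧ A.arm s ω = k}.indicator 1 ω : ℝ≥0∞) =
      if (s : WithTop ℕ) < A.τ ω then 1 else 0 := by
    intro s
    rw [Finset.sum_eq_single (A.arm s ω)]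
    · simp [indicator]
    · intro j _ hj
      simp [indicator, hj.symm]
    · simp
  simp only [hs]
  refine ENNReal.tsum_le_of_sum_range_le fun n => ?_
  cases hτ : A.τ ω with
  | top => exact le_top
  | coe m =>
    rw [Finset.sum_boole]
    have hsub : (Finset.range n).filter (fun s : ℕ => (s : WithTop ℕ) < (m : WithTop ℕ)) ⊆
        Finset.range m := by
      intro s hs
      simpa using (Finset.mem_filter.1 hs).2
    have hcard := Finset.card_le_card hsub
    rw [Finset.card_range] at hcard
    have h' : ENat.toENNReal ((m : ℕ) : ℕ∞) = (m : ℝ≥0∞) := ENat.toENNReal_coe m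
    calc _ ≤ (m : ℝ≥0∞) := Nat.cast_le.2 hcard
      _ = _ := h'.symm

theorem T₀_ne_top {γ : E.means} {μ : Fin K → E.means} (h : ∀ k, γ < μ k) : T₀ E γ μ ≠ ⊤ :=
  ENNReal.sum_ne_top.2 fun k _ => ENNReal.inv_ne_top.2 (E.d_ne_zero (h k).ne')

variable [NeZero K]

/-- Rejection is likely under `μ` and a mistake when slice `k` alone is moved to `b`. Only probes of
slice `k` distinguish the two instances. -/
theorem dB_le_expectedProbes_mul {γ : E.means} {c : Criterion} {μ : Fin K → E.means}
    (h : ∀ k, γ < μ k) (hC : correctAnswers c γ μ = {0}) (hmin : minLoad μ ≠ γ)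
    {δ : unitInterval} (h0 : 0 < (δ : ℝ)) (h1 : (δ : ℝ) ≤ 1 / 2) {A : Algorithm K}
    (hA : A.IsPC E γ c δ) (k : Fin K) {b : E.means} (hb : b < γ) :
    dB δ (unitInterval.symm δ) ≤ expectedProbes E A μ k * E.d (μ k) b := by
  set ν := Function.update μ k b with hν
  obtain ⟨hτ, hμ⟩ := hA μ (identifiable_of_forall_lt c h hmin)
  obtain ⟨-, hνδ⟩ := hA ν (identifiable_update c h k hb)
  have hdec : MeasurableSet[A.isStoppingTime.measurableSpace] {ω | A.decision ω = 0} :=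
    A.measurable_decision (measurableSet_singleton 0)
  have hdec' : MeasurableSet {ω | A.decision ω = 0} :=
    A.isStoppingTime.measurableSpace_le _ hdec
  have hdecτ : ∀ n : ℕ, MeasurableSet[obsSigma A.arm n]
      ({ω | A.decision ω = 0} ∩ {ω | A.τ ω ≤ n}) :=
    fun n => ((A.isStoppingTime.measurableSet _).1 hdec).2 n
  set D : ℕ → Set (Table K) := fun n => {ω | A.decision ω = 0} ∩ {ω | A.τ ω ≤ n} with hD
  -- Truncating at a fixed time keeps every sum finite. As `n` grows, `D n` exhausts rejection up to
  -- a null set, because `τ` is almost surely finite under `μ`.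
  have hDmono : Monotone D := fun m n hmn =>
    inter_subset_inter_right _ fun ω hω => le_trans (show A.τ ω ≤ m from hω) (by exact_mod_cast hmn)
  have hτunion : ⋃ n : ℕ, {ω | A.τ ω ≤ n} = {ω | A.τ ω < ⊤} := by
    ext ω
    simp only [mem_iUnion, mem_ofPred_eq]
    refine ⟨fun ⟨n, hn⟩ => hn.trans_lt (WithTop.coe_lt_top n), fun hω => ?_⟩
    obtain ⟨n, hn⟩ := WithTop.ne_top_iff_exists.1 hω.ne
    exact ⟨n, hn.symm.le⟩
  have hfin : MeasurableSet {ω | A.τ ω < ⊤} := by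
    rw [← hτunion]
    exact MeasurableSet.iUnion fun n =>
      A.obsSigma_le n _ (A.measurableSet_le_time A.isStoppingTime n)
  have hDunion : ⋃ n, D n = {ω | A.decision ω = 0} ∩ {ω | A.τ ω < ⊤} := by
    rw [hD, ← inter_iUnion, hτunion]
  have hlim : Tendsto (fun n => (tableLaw E μ).real (D n)) atTop
      (𝓝 ((tableLaw E μ).real {ω | A.decision ω = 0})) := by
    have h2 := tendsto_measure_iUnion_atTop (μ := tableLaw E μ) hDmono
    rw [hDunion, measure_inter_conull ((prob_compl_eq_zero_iff hfin).2 hτ)] at h2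
    exact (ENNReal.tendsto_toReal (measure_ne_top _ _)).comp h2
  have hp : 1 - (δ : ℝ) ≤ (tableLaw E μ).real {ω | A.decision ω = 0} := by
    have h2 : {ω | A.decision ω ∉ correctAnswers c γ μ} = {ω | A.decision ω = 0}ᶜ := by
      ext ω
      simp [hC]
    rw [h2] at hμ
    have h3 : (tableLaw E μ).real {ω | A.decision ω = 0}ᶜ ≤ δ :=
      ENNReal.toReal_le_of_le_ofReal h0.le hμ
    rw [probReal_compl_eq_one_sub hdec'] at h3
    linarith
  have hq : ∀ n, (tableLaw E ν).real (D n) ≤ δ := by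
    intro n
    refine ENNReal.toReal_le_of_le_ofReal h0.le ((measure_mono fun ω hω => ?_).trans hνδ)
    have h2 : A.decision ω = 0 := hω.1
    simp only [mem_ofPred_eq, h2, zero_mem_correctAnswers_iff, not_forall, not_le]
    exact ⟨k, by simpa [hν] using hb⟩
  have hlog : 0 ≤ Real.log ((1 - δ) / δ) := by
    apply Real.log_nonneg
    rw [le_div_iff₀ h0]
    linarith
  have hbound : ∀ n : ℕ, ENNReal.ofReal
      ((2 * (tableLaw E μ).real (D n) - 1) * Real.log ((1 - δ) / δ)) ≤
      expectedProbes E A μ k * E.d (μ k) b := by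
    intro n
    have h2 := A.mul_log_le_sum_probed E μ ν A.isStoppingTime h0 h1 n (hdecτ n) (fun m hm => ?_)
      (hq n)
    · refine (ENNReal.ofReal_le_ofReal h2).trans ?_
      have h3 : ∀ s : ℕ, ∑ j,
          (tableLaw E μ).real {ω | (s : WithTop ℕ) < A.τ ω ∧ A.arm s ω = j} *
            (E.d (μ j) (ν j)).toReal =
          (tableLaw E μ {ω | (s : WithTop ℕ) < A.τ ω ∧ A.arm s ω = k} * E.d (μ k) b).toReal := by
        intro s
        rw [Finset.sum_eq_single k]
        · rw [ENNReal.toReal_mul, hν, Function.update_self]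
          rfl
        · intro j _ hj
          rw [hν, Function.update_of_ne hj, E.d_self]
          simp
        · simp
      simp only [h3]
      rw [← ENNReal.toReal_sum fun s _ =>
          ENNReal.mul_ne_top (measure_ne_top _ _) (E.d_ne_top _ _), ← Finset.sum_mul]
      exact ENNReal.ofReal_toReal_le.trans (mul_le_mul_left (ENNReal.sum_le_tsum _) _)
    · have h3 : D n ∩ {ω | A.τ ω ≤ m} = D m := by
        ext ω
        simp only [hD, mem_inter_iff, mem_ofPred_eq]
        have : A.τ ω ≤ m → A.τ ω ≤ n := fun h => h.trans (by exact_mod_cast hm.le)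
        tauto
      rw [h3]
      exact hdecτ m
  rw [dB_symm δ h0 (by linarith)]
  -- In the limit `D` has probability at least `1 - δ` under `μ`, so `2 * p - 1 ≥ 1 - 2 * δ`, the
  -- coefficient in `dB_symm`.
  refine le_trans (ENNReal.ofReal_le_ofReal (mul_le_mul_of_nonneg_right ?_ hlog))
    (le_of_tendsto (ENNReal.tendsto_ofReal (((hlim.const_mul 2).sub_const 1).mul_const _))
      (Eventually.of_forall hbound))
  linarith

theorem T₀_mul_dB_le_expectedCost {γ : E.means} {c : Criterion} {μ : Fin K → E.means}
    (h : ∀ k, γ < μ k) (hC : correctAnswers c γ μ = {0}) (hmin : minLoad μ ≠ γ)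
    {δ : unitInterval} (h0 : 0 < (δ : ℝ)) (h1 : (δ : ℝ) ≤ 1 / 2) {A : Algorithm K}
    (hA : A.IsPC E γ c δ) :
    T₀ E γ μ * dB δ (unitInterval.symm δ) ≤ A.expectedCost E μ := by
  refine le_trans ?_ (sum_expectedProbes_le E A μ)
  rw [T₀, Finset.sum_mul]
  refine Finset.sum_le_sum fun k _ => ?_
  obtain ⟨u, hu, hlim⟩ := E.exists_seq_lt_tendsto_d (μ k) γ
  have hd := E.d_ne_zero (h k).ne'
  -- The expected number of probes may be infinite; the product still converges because the limit
  -- divergence is nonzero.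
  have h2 : dB δ (unitInterval.symm δ) ≤ expectedProbes E A μ k * E.d (μ k) γ :=
    ge_of_tendsto (ENNReal.Tendsto.const_mul hlim (Or.inl hd))
      (Eventually.of_forall fun n => dB_le_expectedProbes_mul E h hC hmin h0 h1 hA k (hu n))
  rw [mul_comm, ← div_eq_mul_inv]
  exact ENNReal.div_le_of_le_mul h2

end LowerBound

/-! ### Optimal proportions of measurements -/

section Optimization

variable {K : ℕ} [NeZero K] (E : ExpFamily) {γ : E.means} {c : Criterion} {μ : Fin K → E.means}

/-- Moving one load to just below `γ` bounds the infimum above. Conversely, any alternative has some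
load below `γ`, and by `d_le_d` that slice alone already costs at least `w k * d(μ k, γ)`. -/
theorem objective_eq_iInf (h : ∀ k, γ < μ k) (hC : correctAnswers c γ μ = {0}) (w : Fin K → ℝ) :
    objective E γ c μ w = ⨅ k, ENNReal.ofReal (w k) * E.d (μ k) γ := by
  have halt : ∀ ν, ν ∈ alt E γ c (0 : Fin (K + 1)) ↔ ∃ k, ν k < γ := by
    intro ν
    change ¬ (0 ∈ correctAnswers c γ ν) ↔ _
    rw [zero_mem_correctAnswers_iff]
    simp
  rw [objective, hC]
  simp only [mem_singleton_iff, iSup_iSup_eq_left]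
  apply le_antisymm
  · refine le_iInf fun k => ?_
    obtain ⟨u, hu, hlim⟩ := E.exists_seq_lt_tendsto_d (μ k) γ
    refine ge_of_tendsto (ENNReal.Tendsto.const_mul hlim (Or.inr ENNReal.ofReal_ne_top))
      (Eventually.of_forall fun n => ?_)
    refine (iInf₂_le (Function.update μ k (u n)) ((halt _).2 ⟨k, by simpa using hu n⟩)).trans ?_
    rw [Finset.sum_eq_single k]
    · rw [Function.update_self]
    · intro j _ hj
      rw [Function.update_of_ne hj, E.d_self, mul_zero]
    · simp
  · refine le_iInf₂ fun ν hν => ?_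
    obtain ⟨k, hk⟩ := (halt ν).1 hν
    refine (iInf_le _ k).trans ?_
    refine le_trans ?_ (Finset.single_le_sum (f := fun k => ENNReal.ofReal (w k) *
      E.d (μ k) (ν k)) (fun _ _ => zero_le) (Finset.mem_univ k))
    exact mul_le_mul_right (E.d_le_d hk.le (h k).le) _

/-- The proportions of measurements that equalize the costs of all the slices. -/
def balancedProportions (γ : E.means) (μ : Fin K → E.means) (k : Fin K) : ℝ :=
  ((E.d (μ k) γ)⁻¹ / T₀ E γ μ).toReal

theorem T₀_ne_zero : T₀ E γ μ ≠ 0 := fun h0 => by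
  have h1 := (Finset.sum_eq_zero_iff.1 h0) 0 (Finset.mem_univ _)
  exact E.d_ne_top _ _ (ENNReal.inv_eq_zero.1 h1)

theorem ofReal_balancedProportions (h : ∀ k, γ < μ k) (k : Fin K) :
    ENNReal.ofReal (balancedProportions E γ μ k) = (E.d (μ k) γ)⁻¹ / T₀ E γ μ :=
  ENNReal.ofReal_toReal
    (ENNReal.div_ne_top (ENNReal.inv_ne_top.2 (E.d_ne_zero (h k).ne')) (T₀_ne_zero E))

theorem balancedProportions_mem_stdSimplex (h : ∀ k, γ < μ k) :
    balancedProportions E γ μ ∈ stdSimplex ℝ (Fin K) := by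
  refine ⟨fun k => ENNReal.toReal_nonneg, ?_⟩
  simp only [balancedProportions]
  rw [← ENNReal.toReal_sum fun k _ =>
    ENNReal.div_ne_top (ENNReal.inv_ne_top.2 (E.d_ne_zero (h k).ne')) (T₀_ne_zero E)]
  simp only [div_eq_mul_inv]
  rw [← Finset.sum_mul]
  change (T₀ E γ μ * (T₀ E γ μ)⁻¹).toReal = 1
  rw [ENNReal.mul_inv_cancel (T₀_ne_zero E) (T₀_ne_top E h), ENNReal.toReal_one]

theorem objective_balancedProportions (h : ∀ k, γ < μ k) (hC : correctAnswers c γ μ = {0}) :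
    objective E γ c μ (balancedProportions E γ μ) = (T₀ E γ μ)⁻¹ := by
  rw [objective_eq_iInf E h hC]
  have h1 : ∀ k, ENNReal.ofReal (balancedProportions E γ μ k) * E.d (μ k) γ = (T₀ E γ μ)⁻¹ := by
    intro k
    rw [ofReal_balancedProportions E h, div_eq_mul_inv, mul_right_comm,
      ENNReal.inv_mul_cancel (E.d_ne_zero (h k).ne') (E.d_ne_top _ _), one_mul]
  simp only [h1, iInf_const]

/-- A value of at least `1 / T₀` forces each `w k` to be at least the balanced proportion; equality
of the two sums leaves no slack. This yields uniqueness and, through `objective_le_inv_T₀`,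
optimality as well. -/
theorem eq_balancedProportions_of_le_objective (h : ∀ k, γ < μ k)
    (hC : correctAnswers c γ μ = {0}) {w : Fin K → ℝ} (hw : w ∈ stdSimplex ℝ (Fin K))
    (hle : (T₀ E γ μ)⁻¹ ≤ objective E γ c μ w) : w = balancedProportions E γ μ := by
  rw [objective_eq_iInf E h hC] at hle
  have h1 : ∀ k, balancedProportions E γ μ k ≤ w k := by
    intro k
    have h2 := hle.trans (iInf_le _ k)
    refine ENNReal.toReal_le_of_le_ofReal (hw.1 k) ?_
    rw [div_eq_mul_inv, mul_comm, ← div_eq_mul_inv]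
    exact ENNReal.div_le_of_le_mul h2
  have h3 := (Finset.sum_eq_sum_iff_of_le fun k _ => h1 k).1
    ((balancedProportions_mem_stdSimplex E h).2.trans hw.2.symm)
  exact funext fun k => (h3 k (Finset.mem_univ k)).symm

theorem objective_le_inv_T₀ (h : ∀ k, γ < μ k) (hC : correctAnswers c γ μ = {0}) {w : Fin K → ℝ}
    (hw : w ∈ stdSimplex ℝ (Fin K)) : objective E γ c μ w ≤ (T₀ E γ μ)⁻¹ := by
  rcases le_total (objective E γ c μ w) (T₀ E γ μ)⁻¹ with h1 | h1
  · exact h1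
  · rw [eq_balancedProportions_of_le_objective E h hC hw h1, objective_balancedProportions E h hC]

end Optimization

end AdmissionControl

end

theorem proposition1 {K : ℕ} [NeZero K] (E : AdmissionControl.ExpFamily) (γ : E.means)
    (c : AdmissionControl.Criterion) (μ : Fin K → E.means)
    (hμ : AdmissionControl.minLoad μ ≠ γ)
    (hC : AdmissionControl.correctAnswers c γ μ = {0}) :
    (∀ δ : unitInterval, 0 < (δ : ℝ) → (δ : ℝ) ≤ 1 / 2 →
      ∀ A : AdmissionControl.Algorithm K, A.IsPC E γ c δ →
        AdmissionControl.T₀ E γ μ * AdmissionControl.dB δ (unitInterval.symm δ)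
          ≤ A.expectedCost E μ) ∧
    AdmissionControl.optimalProportions E γ c μ =
      {fun k => ((E.d (μ k) γ)⁻¹ / AdmissionControl.T₀ E γ μ).toReal} ∧
    (⨆ w ∈ stdSimplex ℝ (Fin K), AdmissionControl.objective E γ c μ w) =
      (AdmissionControl.T₀ E γ μ)⁻¹ := by
  have h0 : (0 : Fin (K + 1)) ∈ AdmissionControl.correctAnswers c γ μ := by simp [hC]
  rw [AdmissionControl.zero_mem_correctAnswers_iff] at h0
  have h : ∀ k, γ < μ k := by
    have h1 : γ < AdmissionControl.minLoad μ :=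
      lt_of_le_of_ne ((Finset.le_inf'_iff _ _).2 fun k _ => h0 k) hμ.symm
    exact fun k => h1.trans_le (AdmissionControl.minLoad_le μ k)
  have hmem := AdmissionControl.balancedProportions_mem_stdSimplex E h
  have hval := AdmissionControl.objective_balancedProportions E h hC
  refine ⟨fun δ hδ hδ' A hA =>
    AdmissionControl.T₀_mul_dB_le_expectedCost E h hC hμ hδ hδ' hA, ?_, ?_⟩
  · refine Set.eq_singleton_iff_unique_mem.2 ⟨⟨hmem, fun v hv => ?_⟩, fun w hw => ?_⟩
    · exact (AdmissionControl.objective_le_inv_T₀ E h hC hv).trans hval.ge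
    · exact AdmissionControl.eq_balancedProportions_of_le_objective E h hC hw.1
        (hval.ge.trans (hw.2 _ hmem))
  · exact le_antisymm (iSup₂_le fun w hw => AdmissionControl.objective_le_inv_T₀ E h hC hw)
      (hval.ge.trans (le_iSup₂_of_le _ hmem le_rfl))
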